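/- For an associative ring $R$ with unity, call $R$ left McCoy if whenever $f,g\in R[x]\setminus\{0\}$ satisfy $fg=0$, there is a nonzero $s\in R$ with $sg=0$; right McCoy if whenever $f,g\in R[x]\setminus\{0\}$ satisfy $fg=0$, there is a nonzero $s\in R$ with $fs=0$; McCoy if it is both left and right McCoy; and inner McCoy if whenever $f,g\in R[x]\setminus\{0\}$ satisfy $fgf=0$, there is a nonzero $r\in R$ with $frf=0$. Let $L=\mathbb{Z}_2\langle c_0,c_1,d_0,d_1\rangle$ be the free associative unital algebra over $\mathbb{Z}_2=\mathbb{Z}/2\mathbb{Z}$ in four noncommuting indeterminates, let $J$ be the two-sided ideal of $L$ generated by $$c_0d_0,\quad c_0d_1+c_1d_0,\quad c_1d_1,\quad d_id_j\ (0\le i,j\le 1),\quad d_ic_j\ (0\le i,j\le 1),$$ and let $S=L/J$. Then $S$ is inner McCoy and left McCoy. Moreover, writing bars for images in $S$, the polynomials $F(x)=\bar c_0+\bar c_1x$ and $G(x)=\bar d_0+\bar d_1x$ in $S[x]$ are nonzero and satisfy $F(x)G(x)=0$, but $F(x)r\neq 0$ for every nonzero $r\in S$. In particular, $S$ is not right McCoy,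 and hence $S$ is not McCoy. -/

import Mathlib

open Polynomial

/-- `R` is left McCoy: if `f g = 0` with `f, g` nonzero in `R[x]`, then some nonzero `s` in `R`
satisfies `s g = 0`. -/
def IsLeftMcCoy (R : Type*) [Ring R] : Prop :=
  ∀ f g : R[X], f ≠ 0 → g ≠ 0 → f * g = 0 → ∃ s : R, s ≠ 0 ∧ C s * g = 0

/-- `R` is right McCoy: if `f g = 0` with `f, g` nonzero in `R[x]`, then some nonzero `s` in `R`
satisfies `f s = 0`. -/
def IsRightMcCoy (R : Type*) [Ring R] : Prop :=
  ∀ f g : R[X], f ≠ 0 → g ≠ 0 → f * g = 0 → ∃ s : R, s ≠ 0 ∧ f * C s = 0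

/-- `R` is McCoy: both left and right McCoy. -/
def IsMcCoy (R : Type*) [Ring R] : Prop :=
  IsLeftMcCoy R ∧ IsRightMcCoy R

/-- `R` is inner McCoy: if `f g f = 0` with `f, g` nonzero in `R[x]`, then some nonzero `r` in `R`
satisfies `f r f = 0`. -/
def IsInnerMcCoy (R : Type*) [Ring R] : Prop :=
  ∀ f g : R[X], f ≠ 0 → g ≠ 0 → f * g * f = 0 → ∃ r : R, r ≠ 0 ∧ f * C r * f = 0

namespace Nielsen

/-- The four noncommuting indeterminates `c 0, c 1, d 0, d 1`. -/
inductive Gen : Type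
  | c (i : Fin 2)
  | d (i : Fin 2)

/-- The free algebra `ℤ₂⟨c₀, c₁, d₀, d₁⟩`. -/
abbrev L : Type := FreeAlgebra (ZMod 2) Gen

/-- The indeterminate `c i` of `L`. -/
noncomputable def cL (i : Fin 2) : L := FreeAlgebra.ι (ZMod 2) (Gen.c i)

/-- The indeterminate `d i` of `L`. -/
noncomputable def dL (i : Fin 2) : L := FreeAlgebra.ι (ZMod 2) (Gen.d i)

/-- The defining relations. -/
def relators : Set L :=
  {cL 0 * dL 0, cL 0 * dL 1 + cL 1 * dL 0, cL 1 * dL 1} ∪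
    {z | ∃ i j : Fin 2, z = dL i * dL j} ∪ {z | ∃ i j : Fin 2, z = dL i * cL j}

/-- The two-sided ideal of `L` generated by the defining relations. -/
def J : TwoSidedIdeal L := TwoSidedIdeal.span relators

/-- The quotient ring `L / J`. -/
abbrev S : Type := J.ringCon.Quotient

/-- The quotient map `L → S`. -/
def toS : L →+* S := J.ringCon.mk'

/-- The polynomial `c₀ + c₁ x` over `S`. -/
noncomputable def F : S[X] := C (toS (cL 0)) + C (toS (cL 1)) * X

/-- The polynomial `d₀ + d₁ x` over `S`. -/
noncomputable def G : S[X] := C (toS (dL 0)) + C (toS (dL 1)) * X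

end Nielsen

/-!
Write `e = c₁d₀ = c₀d₁`. Every element of `S` is uniquely `s = a + γ₀d₀ + γ₁d₁ + be` with `a`, `b`
in the free algebra `A = ℤ₂⟨c₀, c₁⟩` and `γ₀`, `γ₁` in `ℤ₂`. Uniqueness comes from a representation
by upper triangular matrices over `A`, under which

        ⎡ a   *     *     b   ⎤
        ⎢ 0  ε(a)   0     γ₀  ⎥
  s  ↦  ⎢ 0   0    ε(a)   γ₁  ⎥
        ⎣ 0   0     0    ε(a) ⎦

where `ε` is the augmentation of `A`. Multiplying an element with `a = 0` by `s` on the right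
scales it by `ε(s) = ε(a)`.

A polynomial over `S` whose image under `ε` is nonzero is therefore regular: on the left by back
substitution, because the triangular representation is faithful and `A[x]` is a domain, and on the
right because, after passing to `a = 0`, it acts as a nonzero polynomial over the field `ℤ₂`. A
polynomial whose image under `ε` is zero is killed by `d₀` on the left. This dichotomy gives the
left and the inner McCoy property.
-/

section McCoyCriteria

variable {R : Type*} [Ring R] {d : R}

theorem IsLeftMcCoy.of_isRightRegular_or (hd : d ≠ 0)
    (h : ∀ g : R[X], IsRightRegular g ∨ C d * g = 0) : IsLeftMcCoy R := by
  intro f g hf _ hfg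
  exact ⟨d, hd, (h g).resolve_left fun hg => hf (hg.mul_right_eq_zero_iff.1 hfg)⟩

theorem IsInnerMcCoy.of_isRegular_or (hd : d ≠ 0)
    (h : ∀ f : R[X], IsRegular f ∨ C d * f = 0) : IsInnerMcCoy R := by
  intro f g _ hg hfgf
  refine ⟨d, hd, ?_⟩
  rcases h f with hf | hf
  · exact absurd (hf.left.mul_left_eq_zero_iff.1 (hf.right.mul_right_eq_zero_iff.1 hfgf)) hg
  · rw [mul_assoc, hf, mul_zero]

end McCoyCriteria

section Triangular

variable {n B : Type*} [Fintype n] [LinearOrder n]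

theorem mul_apply_of_isUpperTriangular [NonUnitalNonAssocSemiring B] {M N : Matrix n n B}
    (hM : M.IsUpperTriangular) {i k : n} (hN : ∀ j, i < j → N j k = 0) :
    (M * N) i k = M i i * N i k := by
  rw [Matrix.mul_apply]
  refine Finset.sum_eq_single i (fun j _ hji => ?_) (by simp)
  rcases hji.lt_or_gt with hlt | hgt
  · rw [hM hlt, zero_mul]
  · rw [hN j hgt, mul_zero]

theorem eq_zero_of_isUpperTriangular_mul_eq_zero [NonUnitalNonAssocSemiring B] [NoZeroDivisors B]
    {M N : Matrix n n B} (hM : M.IsUpperTriangular) (hdiag : ∀ i, M i i ≠ 0) (h : M * N = 0) :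
    N = 0 := by
  ext i k
  induction i using WellFoundedGT.induction with
  | ind i ih =>
    have hmul : M i i * N i k = 0 := by
      rw [← mul_apply_of_isUpperTriangular hM ih, h, Matrix.zero_apply]
    exact (mul_eq_zero.1 hmul).resolve_left (hdiag i)

end Triangular

section RegularPolynomials

section Rep

variable {R B n : Type*} [Semiring R] [Semiring B] [Fintype n] [DecidableEq n]

/-- The extension of a matrix representation of `R` over `B` to a matrix representation of `R[X]`
over `B[X]`, sending `X` to the scalar matrix `X`. -/
noncomputable def polynomialRep (ρ : R →+* Matrix n n B) :
    R[X] →+* Matrix n n B[X] :=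
  eval₂RingHom' ((C : B →+* B[X]).mapMatrix.comp ρ) (Matrix.scalar n X) fun _ =>
    (Matrix.scalar_commute X (fun p => commute_X p) _).symm

theorem coeff_polynomialRep (ρ : R →+* Matrix n n B) (f : R[X]) (i j : n) (k : ℕ) :
    (polynomialRep ρ f i j).coeff k = ρ (f.coeff k) i j := by
  induction f using Polynomial.induction_on' with
  | add p q hp hq => simp only [map_add, Matrix.add_apply, coeff_add, hp, hq]
  | monomial m r =>
    have : polynomialRep ρ (monomial m r) i j = monomial m (ρ r i j) := by
      simp [polynomialRep, eval₂RingHom', eval₂_monomial, Matrix.diagonal_pow,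
        C_mul_X_pow_eq_monomial]
    rw [this, coeff_monomial, coeff_monomial]
    split_ifs <;> simp

end Rep

theorem isLeftRegular_of_isUpperTriangular_rep {R B n : Type*} [Ring R] [Semiring B]
    [NoZeroDivisors B] [Fintype n] [LinearOrder n] {ρ : R →+* Matrix n n B}
    (hρ : Function.Injective ρ) (htri : ∀ s, (ρ s).IsUpperTriangular) {f : R[X]}
    (hf : ∀ i, ∃ k, ρ (f.coeff k) i i ≠ 0) :
    IsLeftRegular f := by
  refine isLeftRegular_iff_right_eq_zero_of_mul.2 fun g hfg => ?_
  have htri' : (polynomialRep ρ f).IsUpperTriangular := by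
    intro i j hij
    ext k
    rw [coeff_polynomialRep, htri _ hij, coeff_zero]
  have hdiag (i : n) : polynomialRep ρ f i i ≠ 0 := by
    obtain ⟨k, hk⟩ := hf i
    exact fun h => hk (by rw [← coeff_polynomialRep, h, coeff_zero])
  have hg : polynomialRep ρ g = 0 :=
    eq_zero_of_isUpperTriangular_mul_eq_zero htri' hdiag (by rw [← map_mul, hfg, map_zero])
  ext k
  refine (map_eq_zero_iff ρ hρ).1 (Matrix.ext fun i j => ?_)
  rw [← coeff_polynomialRep, hg, Matrix.zero_apply, coeff_zero, Matrix.zero_apply]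

theorem isRightRegular_of_mul_eq_smul {K R B : Type*} [Field K] [Ring R] [Algebra K R]
    [Semiring B] [NoZeroDivisors B] {π : R →+* B} {ε : R →+* K} (hε : ∀ s, π s = 0 → ε s = 0)
    (h : ∀ m s, π m = 0 → m * s = ε s • m) {g : R[X]} (hg : g.map ε ≠ 0) :
    IsRightRegular g := by
  refine isRightRegular_iff_left_eq_zero_of_mul.2 fun f hfg => ?_
  have hgπ : g.map π ≠ 0 := by
    refine fun hgπ => hg (Polynomial.ext fun k => ?_)
    rw [coeff_map, hε _ (by rw [← coeff_map, hgπ, coeff_zero]), coeff_zero]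
  have hfπ : f.map π = 0 := by
    have := congrArg (Polynomial.map π) hfg
    rw [Polynomial.map_mul, Polynomial.map_zero, mul_eq_zero] at this
    exact this.resolve_right hgπ
  have hscalar : f * (g.map ε).map (algebraMap K R) = f * g := by
    ext k
    simp only [coeff_mul, coeff_map]
    refine Finset.sum_congr rfl fun p _ => ?_
    have hp : π (f.coeff p.1) = 0 := by rw [← coeff_map, hfπ, coeff_zero]
    rw [h _ (g.coeff p.2) hp, Algebra.smul_def, Algebra.commutes]
  have hR : Nontrivial R :=
    Nontrivial.of_polynomial_ne (p := g) (q := 0) fun h0 => hg (by rw [h0, Polynomial.map_zero])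
  have hlead : IsUnit ((g.map ε).map (algebraMap K R)).leadingCoeff := by
    rw [leadingCoeff_map_of_injective (algebraMap K R).injective]
    exact (leadingCoeff_ne_zero.2 hg).isUnit.map (algebraMap K R)
  exact (isUnit_leadingCoeff_mul_left_eq_zero_iff hlead).1 (hscalar.trans hfg)

theorem C_mul_eq_zero_of_mul_eq_smul {K R : Type*} [CommSemiring K] [Semiring R] [Algebra K R]
    {ε : R →+* K} {d : R} (hd : ∀ s, d * s = ε s • d) {g : R[X]} (hg : g.map ε = 0) :
    C d * g = 0 := by
  ext k
  have hk : ε (g.coeff k) = 0 := by rw [← coeff_map, hg, coeff_zero]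
  rw [coeff_C_mul, hd, hk, zero_smul, coeff_zero]

end RegularPolynomials

namespace Nielsen

/-- The free algebra `ℤ₂⟨c₀, c₁⟩`, with `c i` encoded by its index `i`. -/
abbrev A : Type := FreeAlgebra (ZMod 2) (Fin 2)

/-- The augmentation of `A`: the constant term of a noncommutative polynomial. -/
noncomputable abbrev aug : A →ₐ[ZMod 2] ZMod 2 := FreeAlgebra.algebraMapInv

theorem aug_ι (i : Fin 2) : aug (FreeAlgebra.ι (ZMod 2) i) = 0 := by
  simp [FreeAlgebra.algebraMapInv]

theorem ι_mul_eq_zero_iff {i : Fin 2} {a : A} : FreeAlgebra.ι (ZMod 2) i * a = 0 ↔ a = 0 := by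
  rw [mul_eq_zero, or_iff_right (FreeAlgebra.ι_ne_zero i)]

/-- The image of the indeterminate `c i` in `S`. -/
noncomputable def cS (i : Fin 2) : S := toS (cL i)

/-- The image of the indeterminate `d i` in `S`. -/
noncomputable def dS (i : Fin 2) : S := toS (dL i)

/-- The common value `c₁ d₀ = c₀ d₁` in `S` of the nonzero products of a `c` with a `d`. -/
noncomputable def cdS : S := cS 1 * dS 0

theorem toS_eq_zero_of_mem {z : L} (hz : z ∈ relators) : toS z = 0 :=
  (RingCon.eq _).2 (TwoSidedIdeal.subset_span hz)

theorem dS_mul_dS (i j : Fin 2) : dS i * dS j = 0 := by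
  rw [dS, dS, ← map_mul]
  exact toS_eq_zero_of_mem (Or.inl (Or.inr ⟨i, j, rfl⟩))

theorem dS_mul_cS (i j : Fin 2) : dS i * cS j = 0 := by
  rw [dS, cS, ← map_mul]
  exact toS_eq_zero_of_mem (Or.inr ⟨i, j, rfl⟩)

theorem cS_mul_dS_self (i : Fin 2) : cS i * dS i = 0 := by
  rw [cS, dS, ← map_mul]
  refine toS_eq_zero_of_mem (Or.inl (Or.inl ?_))
  fin_cases i
  · exact Or.inl rfl
  · exact Or.inr (Or.inr rfl)

theorem cS_zero_mul_dS_one_add : cS 0 * dS 1 + cS 1 * dS 0 = 0 := by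
  simp only [cS, dS, ← map_mul, ← map_add]
  exact toS_eq_zero_of_mem (Or.inl (Or.inl (Or.inr (Or.inl rfl))))

/-- In `Fin 2`, `i + 1` is the index other than `i`. -/
theorem cS_mul_sum_smul_dS (i : Fin 2) (γ : Fin 2 → ZMod 2) :
    cS i * ∑ j, γ j • dS j = γ (i + 1) • cdS := by
  have h01 : cS 0 * dS 1 = cdS :=
    add_right_cancel (cS_zero_mul_dS_one_add.trans (ZModModule.add_self cdS).symm)
  fin_cases i
  · simp [mul_add, cS_mul_dS_self, h01]
  · simp [mul_add, cS_mul_dS_self, cdS]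

@[elab_as_elim]
theorem S.induction {P : S → Prop} (algebraMap : ∀ r, P (algebraMap (ZMod 2) S r))
    (c : ∀ i, P (cS i)) (d : ∀ i, P (dS i)) (mul : ∀ s t, P s → P t → P (s * t))
    (add : ∀ s t, P s → P t → P (s + t)) (s : S) : P s := by
  obtain ⟨z, rfl⟩ : ∃ z, toS z = s := RingCon.mk'_surjective _ s
  induction z using FreeAlgebra.induction with
  | grade0 r => exact algebraMap r
  | grade1 x =>
    cases x with
    | c i => exact c i
    | d i => exact d i
  | mul a b ha hb => rw [map_mul]; exact mul _ _ ha hb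
  | add a b ha hb => rw [map_add]; exact add _ _ ha hb

section Lift

variable {B : Type*} [Ring B] [Algebra (ZMod 2) B] (c d : Fin 2 → B)
  (hcd : ∀ i, c i * d i = 0) (hadd : c 0 * d 1 + c 1 * d 0 = 0)
  (hdd : ∀ i j, d i * d j = 0) (hdc : ∀ i j, d i * c j = 0)

/-- The universal property of `S`: elements of an algebra over `ℤ₂` that satisfy the defining
relations are the images of the indeterminates under an algebra homomorphism. -/
noncomputable def liftS : S →ₐ[ZMod 2] B :=
  let φ : L →ₐ[ZMod 2] B := FreeAlgebra.lift (ZMod 2) fun | .c i => c i | .d i => d i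
  J.ringCon.liftₐ φ <| by
    have hJ : J ≤ TwoSidedIdeal.ker φ := TwoSidedIdeal.span_le.2 fun z hz => by
      rw [SetLike.mem_coe, TwoSidedIdeal.mem_ker]
      rcases hz with ((rfl | rfl | rfl) | ⟨i, j, rfl⟩) | ⟨i, j, rfl⟩ <;>
        simp [φ, cL, dL, hcd, hadd, hdd, hdc]
    exact TwoSidedIdeal.ringCon_le_iff.1 hJ

theorem liftS_cS (i : Fin 2) : liftS c d hcd hadd hdd hdc (cS i) = c i :=
  FreeAlgebra.lift_ι_apply _ (Gen.c i)

theorem liftS_dS (i : Fin 2) : liftS c d hcd hadd hdd hdc (dS i) = d i :=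
  FreeAlgebra.lift_ι_apply _ (Gen.d i)

end Lift

/-- The projection of `S` onto `A` that kills `d 0` and `d 1`. -/
noncomputable def toA : S →ₐ[ZMod 2] A :=
  liftS (FreeAlgebra.ι (ZMod 2)) 0 (by simp) (by simp) (by simp) (by simp)

theorem toA_cS (i : Fin 2) : toA (cS i) = FreeAlgebra.ι (ZMod 2) i := liftS_cS ..

theorem toA_dS (i : Fin 2) : toA (dS i) = 0 := liftS_dS ..

/-- The augmentation of `S`, killing all four indeterminates. -/
noncomputable def augS : S →ₐ[ZMod 2] ZMod 2 := aug.comp toA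

theorem augS_apply (s : S) : augS s = aug (toA s) := rfl

/-- The inclusion of `A` into `S`. -/
noncomputable def ofA : A →ₐ[ZMod 2] S := FreeAlgebra.lift (ZMod 2) cS

theorem ofA_ι (i : Fin 2) : ofA (FreeAlgebra.ι (ZMod 2) i) = cS i := FreeAlgebra.lift_ι_apply ..

theorem toA_ofA (a : A) : toA (ofA a) = a := by
  have : toA.comp ofA = AlgHom.id _ _ := by
    ext i
    simp [ofA_ι, toA_cS]
  exact DFunLike.congr_fun this a

theorem dS_mul (i : Fin 2) (s : S) : dS i * s = augS s • dS i := by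
  induction s using S.induction with
  | algebraMap r => simp [← Algebra.commutes, ← Algebra.smul_def]
  | c j => rw [dS_mul_cS, augS_apply, toA_cS, aug_ι, zero_smul]
  | d j => rw [dS_mul_dS, augS_apply, toA_dS, map_zero, zero_smul]
  | mul s t hs ht => rw [← mul_assoc, hs, smul_mul_assoc, ht, smul_smul, map_mul]
  | add s t hs ht => rw [mul_add, hs, ht, map_add, add_smul]

theorem cdS_mul (s : S) : cdS * s = augS s • cdS := by
  rw [cdS, mul_assoc, dS_mul, mul_smul_comm]

/-- The element `a + γ₀ d₀ + γ₁ d₁ + b c₁ d₀` of `S`; every element of `S` has a unique such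
form. -/
noncomputable def ofNormalForm (a : A) (γ : Fin 2 → ZMod 2) (b : A) : S :=
  ofA a + ∑ i, γ i • dS i + ofA b * cdS

theorem ofNormalForm_add (a a' : A) (γ γ' : Fin 2 → ZMod 2) (b b' : A) :
    ofNormalForm (a + a') (γ + γ') (b + b') = ofNormalForm a γ b + ofNormalForm a' γ' b' := by
  simp only [ofNormalForm, map_add, Pi.add_apply, add_smul, Finset.sum_add_distrib, add_mul]
  abel

theorem smul_ofNormalForm (r : ZMod 2) (a : A) (γ : Fin 2 → ZMod 2) (b : A) :
    r • ofNormalForm a γ b = ofNormalForm (r • a) (r • γ) (r • b) := by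
  simp only [ofNormalForm, smul_add, Finset.smul_sum, map_smul, Pi.smul_apply, smul_assoc,
    smul_mul_assoc]

theorem cS_mul_ofNormalForm (i : Fin 2) (a : A) (γ : Fin 2 → ZMod 2) (b : A) :
    cS i * ofNormalForm a γ b = ofNormalForm (FreeAlgebra.ι (ZMod 2) i * a) 0
      (algebraMap _ _ (γ (i + 1)) + FreeAlgebra.ι (ZMod 2) i * b) := by
  simp only [ofNormalForm, mul_add, cS_mul_sum_smul_dS, map_add, map_mul, ofA_ι, Pi.zero_apply,
    zero_smul, Finset.sum_const_zero, add_zero, AlgHom.commutes, add_mul, ← Algebra.smul_def,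
    mul_assoc, add_assoc]

theorem toA_ofNormalForm (a : A) (γ : Fin 2 → ZMod 2) (b : A) :
    toA (ofNormalForm a γ b) = a := by
  simp [ofNormalForm, cdS, toA_ofA, toA_dS]

theorem dS_eq_ofNormalForm (i : Fin 2) : dS i = ofNormalForm 0 (Pi.single i 1) 0 := by
  simp [ofNormalForm, Pi.single_apply]

theorem exists_eq_ofNormalForm (s : S) : ∃ a γ b, s = ofNormalForm a γ b := by
  suffices h : ∀ t, (∃ a γ b, t = ofNormalForm a γ b) → ∃ a γ b, s * t = ofNormalForm a γ b by
    simpa using h 1 ⟨1, 0, 0, by simp [ofNormalForm]⟩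
  induction s using S.induction with
  | algebraMap r =>
    rintro _ ⟨a, γ, b, rfl⟩
    exact ⟨_, _, _, by rw [← Algebra.smul_def, smul_ofNormalForm]⟩
  | c i =>
    rintro _ ⟨a, γ, b, rfl⟩
    exact ⟨_, _, _, cS_mul_ofNormalForm i a γ b⟩
  | d i =>
    intro t _
    exact ⟨_, _, _, by rw [dS_mul, dS_eq_ofNormalForm, smul_ofNormalForm]⟩
  | mul s s' hs hs' =>
    intro t ht
    rw [mul_assoc]
    exact hs _ (hs' _ ht)
  | add s s' hs hs' =>
    intro t ht
    obtain ⟨a, γ, b, h⟩ := hs t ht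
    obtain ⟨a', γ', b', h'⟩ := hs' t ht
    exact ⟨_, _, _, by rw [add_mul, h, h', ← ofNormalForm_add]⟩

theorem mul_eq_smul_of_toA_eq_zero {m : S} (s : S) (hm : toA m = 0) :
    m * s = augS s • m := by
  obtain ⟨a, γ, b, rfl⟩ := exists_eq_ofNormalForm m
  rw [toA_ofNormalForm] at hm
  simp only [ofNormalForm, hm, map_zero, zero_add, add_mul, Finset.sum_mul, smul_mul_assoc, dS_mul,
    mul_assoc, cdS_mul, mul_smul_comm, smul_add, Finset.smul_sum, smul_comm (augS s)]

/-- The matrix representing `c i`. The column of its entry `1` is the row of the entry `1` of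
`dMatrix (i + 1)`, because `c i * d (i + 1)` is the nonzero product. -/
noncomputable def cMatrix (i : Fin 2) : Matrix (Fin 4) (Fin 4) A :=
  .single 0 0 (FreeAlgebra.ι (ZMod 2) i) +
    .single 0 (![2, 1] i) 1

/-- The matrix representing `d i`: its last column is that of the normal form of `d i`. -/
noncomputable def dMatrix (i : Fin 2) : Matrix (Fin 4) (Fin 4) A :=
  .single (![1, 2] i) 3 1

theorem cMatrix_isUpperTriangular (i : Fin 2) : (cMatrix i).IsUpperTriangular :=
  (Matrix.blockTriangular_single (i := 0) (j := 0) le_rfl _).add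
    (Matrix.blockTriangular_single (i := 0) (Fin.zero_le _) _)

theorem dMatrix_isUpperTriangular (i : Fin 2) : (dMatrix i).IsUpperTriangular :=
  Matrix.blockTriangular_single (Fin.le_last _) _

/-- The upper triangular matrix representation of `S` over `A`, in which the coefficients of the
normal form can be read off from the first diagonal entry and the last column. -/
noncomputable def rep : S →ₐ[ZMod 2] Matrix (Fin 4) (Fin 4) A :=
  liftS cMatrix dMatrix
    (by intro i; fin_cases i <;> simp [cMatrix, dMatrix, add_mul])
    (by simp [cMatrix, dMatrix, add_mul, ZModModule.add_self])
    (by intro i j; fin_cases i <;> fin_cases j <;> simp [dMatrix])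
    (by intro i j; simp [cMatrix, dMatrix, mul_add])

theorem rep_cS (i : Fin 2) : rep (cS i) = cMatrix i := liftS_cS ..

theorem rep_dS (i : Fin 2) : rep (dS i) = dMatrix i := liftS_dS ..

theorem rep_isUpperTriangular (s : S) : (rep s).IsUpperTriangular := by
  induction s using S.induction with
  | algebraMap r => rw [AlgHom.commutes]; exact Matrix.blockTriangular_algebraMap r
  | c i => rw [rep_cS]; exact cMatrix_isUpperTriangular i
  | d i => rw [rep_dS]; exact dMatrix_isUpperTriangular i
  | mul s t hs ht => rw [map_mul]; exact hs.mul ht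
  | add s t hs ht => rw [map_add]; exact hs.add ht

theorem rep_apply_self (s : S) (i : Fin 4) :
    rep s i i = ![toA s, algebraMap (ZMod 2) A (augS s), algebraMap (ZMod 2) A (augS s),
      algebraMap (ZMod 2) A (augS s)] i := by
  induction s using S.induction with
  | algebraMap r => fin_cases i <;> simp [Matrix.algebraMap_matrix_apply]
  | c j => fin_cases i <;> fin_cases j <;> simp [rep_cS, cMatrix, augS_apply, toA_cS, aug_ι]
  | d j => fin_cases i <;> fin_cases j <;> simp [rep_dS, dMatrix, augS_apply, toA_dS]
  | mul s t hs ht =>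
    have hdiag : (rep s * rep t) i i = rep s i i * rep t i i :=
      mul_apply_of_isUpperTriangular (rep_isUpperTriangular s) fun _ hj =>
        rep_isUpperTriangular t hj
    rw [map_mul, hdiag, hs, ht]
    fin_cases i <;> simp
  | add s t hs ht =>
    rw [map_add, Matrix.add_apply, hs, ht]
    fin_cases i <;> simp

theorem rep_ofA_apply_last (a : A) (i : Fin 4) :
    rep (ofA a) i 3 = ![0, 0, 0, algebraMap (ZMod 2) A (aug a)] i := by
  induction a using FreeAlgebra.induction generalizing i with
  | grade0 r => fin_cases i <;> simp [Matrix.algebraMap_matrix_apply]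
  | grade1 j => fin_cases i <;> fin_cases j <;> simp [ofA_ι, rep_cS, cMatrix, aug_ι]
  | mul a b ha hb =>
    rw [map_mul, map_mul, Matrix.mul_apply, Fin.sum_univ_four]
    fin_cases i <;> simp [ha, hb]
  | add a b ha hb =>
    rw [map_add, map_add, Matrix.add_apply, ha, hb]
    fin_cases i <;> simp

theorem rep_cdS : rep cdS = .single 0 3 1 := by
  rw [cdS, map_mul, rep_cS, rep_dS]
  simp [cMatrix, dMatrix, add_mul]

theorem rep_ofA_mul_cdS_apply_last (b : A) (i : Fin 4) :
    rep (ofA b * cdS) i 3 = ![b, 0, 0, 0] i := by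
  rw [map_mul, rep_cdS, Matrix.mul_single_apply_same, mul_one]
  refine Fin.cases ?_ (fun j => ?_) i
  · exact (rep_apply_self (ofA b) 0).trans (toA_ofA b)
  · have hj : rep (ofA b) j.succ 0 = 0 := rep_isUpperTriangular _ (Fin.succ_pos j)
    rw [hj]
    fin_cases j <;> rfl

theorem rep_ofNormalForm_apply_last (a : A) (γ : Fin 2 → ZMod 2) (b : A) (i : Fin 4) :
    rep (ofNormalForm a γ b) i 3 = ![b, algebraMap (ZMod 2) A (γ 0),
      algebraMap (ZMod 2) A (γ 1), algebraMap (ZMod 2) A (aug a)] i := by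
  rw [ofNormalForm, map_add, map_add, Matrix.add_apply, Matrix.add_apply, rep_ofA_apply_last,
    rep_ofA_mul_cdS_apply_last]
  fin_cases i <;> simp [rep_dS, dMatrix, Algebra.algebraMap_eq_smul_one]

theorem eq_zero_of_rep_ofNormalForm_eq_zero {a : A} {γ : Fin 2 → ZMod 2} {b : A}
    (h : rep (ofNormalForm a γ b) = 0) : a = 0 ∧ γ = 0 ∧ b = 0 := by
  have hlast (i : Fin 4) : ![b, algebraMap (ZMod 2) A (γ 0), algebraMap (ZMod 2) A (γ 1),
      algebraMap (ZMod 2) A (aug a)] i = 0 := by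
    rw [← rep_ofNormalForm_apply_last, h, Matrix.zero_apply]
  refine ⟨?_, funext fun i => ?_, hlast 0⟩
  · have hfirst := rep_apply_self (ofNormalForm a γ b) 0
    rw [h, toA_ofNormalForm] at hfirst
    exact hfirst.symm
  · fin_cases i
    · simpa using hlast 1
    · simpa using hlast 2

theorem rep_injective : Function.Injective rep := by
  refine (injective_iff_map_eq_zero rep).2 fun s hs => ?_
  obtain ⟨a, γ, b, rfl⟩ := exists_eq_ofNormalForm s
  obtain ⟨rfl, rfl, rfl⟩ := eq_zero_of_rep_ofNormalForm_eq_zero hs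
  simp [ofNormalForm]

theorem dS_ne_zero (i : Fin 2) : dS i ≠ 0 := by
  intro h
  have hγ := (eq_zero_of_rep_ofNormalForm_eq_zero
    (by rw [← dS_eq_ofNormalForm, h, map_zero])).2.1
  simpa using congrFun hγ i

theorem cS_ne_zero (i : Fin 2) : cS i ≠ 0 := by
  intro h
  have hι := toA_cS i
  rw [h, map_zero] at hι
  exact FreeAlgebra.ι_ne_zero i hι.symm

theorem eq_zero_of_cS_mul_eq_zero {r : S} (h : ∀ i, cS i * r = 0) : r = 0 := by
  obtain ⟨a, γ, b, rfl⟩ := exists_eq_ofNormalForm r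
  have hmul (i : Fin 2) := eq_zero_of_rep_ofNormalForm_eq_zero
    (by rw [← cS_mul_ofNormalForm, h i, map_zero])
  have hγ (i : Fin 2) : γ (i + 1) = 0 := by
    simpa [aug_ι] using congrArg aug (hmul i).2.2
  have ha : a = 0 := ι_mul_eq_zero_iff.1 (hmul 0).1
  have hb : b = 0 := by
    have := (hmul 0).2.2
    rwa [hγ, map_zero, zero_add, ι_mul_eq_zero_iff] at this
  have hγ' : γ = 0 := by
    ext i
    fin_cases i
    · exact hγ 1
    · exact hγ 0
  simp [ofNormalForm, ha, hb, hγ']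

theorem isLeftRegular_of_map_augS_ne_zero {f : S[X]} (hf : f.map (augS : S →+* ZMod 2) ≠ 0) :
    IsLeftRegular f := by
  obtain ⟨k, hk⟩ : ∃ k, augS (f.coeff k) ≠ 0 := by
    by_contra! h
    exact hf (Polynomial.ext fun k => by simpa using h k)
  have htoA : toA (f.coeff k) ≠ 0 := fun h => hk (by rw [augS_apply, h, map_zero])
  refine isLeftRegular_of_isUpperTriangular_rep (ρ := (rep : S →+* Matrix (Fin 4) (Fin 4) A))
    rep_injective rep_isUpperTriangular fun i => ⟨k, ?_⟩
  rw [RingHom.coe_coe, rep_apply_self]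
  fin_cases i <;> simp [hk, htoA]

theorem isRightRegular_of_map_augS_ne_zero {f : S[X]} (hf : f.map (augS : S →+* ZMod 2) ≠ 0) :
    IsRightRegular f :=
  isRightRegular_of_mul_eq_smul (π := (toA : S →+* A))
    (fun s (hs : toA s = 0) => (congrArg aug hs).trans (map_zero aug))
    (fun _ s hm => mul_eq_smul_of_toA_eq_zero s hm) hf

theorem isRegular_or_C_dS_mul_eq_zero (i : Fin 2) (f : S[X]) :
    IsRegular f ∨ C (dS i) * f = 0 := by
  by_cases hf : f.map (augS : S →+* ZMod 2) = 0
  · exact Or.inr (C_mul_eq_zero_of_mul_eq_smul (dS_mul i) hf)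
  · exact Or.inl ⟨isLeftRegular_of_map_augS_ne_zero hf, isRightRegular_of_map_augS_ne_zero hf⟩

theorem isLeftMcCoy : IsLeftMcCoy S :=
  .of_isRightRegular_or (dS_ne_zero 0) fun g =>
    (isRegular_or_C_dS_mul_eq_zero 0 g).imp_left IsRegular.right

theorem isInnerMcCoy : IsInnerMcCoy S :=
  .of_isRegular_or (dS_ne_zero 0) (isRegular_or_C_dS_mul_eq_zero 0)

theorem F_ne_zero : F ≠ 0 := by
  intro h
  apply cS_ne_zero 0
  simpa [F, cS] using congrArg (coeff · 0) h

theorem G_ne_zero : G ≠ 0 := by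
  intro h
  apply dS_ne_zero 0
  simpa [G, dS] using congrArg (coeff · 0) h

theorem F_mul_G : F * G = 0 := by
  have hexpand : F * G =
      C (cS 0 * dS 0) + C (cS 0 * dS 1 + cS 1 * dS 0) * X + C (cS 1 * dS 1) * X ^ 2 := by
    simp only [F, G, cS, dS, C_mul, C_add, add_mul, mul_add, mul_assoc, X_mul, pow_two]
    abel
  rw [hexpand, cS_mul_dS_self, cS_zero_mul_dS_one_add, cS_mul_dS_self]
  simp

theorem F_mul_C_ne_zero {r : S} (hr : r ≠ 0) : F * C r ≠ 0 := by
  intro h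
  refine hr (eq_zero_of_cS_mul_eq_zero fun i => ?_)
  fin_cases i
  · simpa [F, cS] using congrArg (coeff · 0) h
  · simpa [F, cS, coeff_C] using congrArg (coeff · 1) h

theorem not_isRightMcCoy : ¬ IsRightMcCoy S := by
  intro h
  obtain ⟨s, hs, hFs⟩ := h F G F_ne_zero G_ne_zero F_mul_G
  exact F_mul_C_ne_zero hs hFs

end Nielsen

theorem mainTheorem9 :
    IsInnerMcCoy Nielsen.S ∧
    IsLeftMcCoy Nielsen.S ∧
    (Nielsen.F ≠ 0 ∧ Nielsen.G ≠ 0 ∧ Nielsen.F * Nielsen.G = 0 ∧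
      ∀ r : Nielsen.S, r ≠ 0 → Nielsen.F * Polynomial.C r ≠ 0) ∧
    ¬ IsRightMcCoy Nielsen.S ∧
    ¬ IsMcCoy Nielsen.S :=
  ⟨Nielsen.isInnerMcCoy, Nielsen.isLeftMcCoy,
    ⟨Nielsen.F_ne_zero, Nielsen.G_ne_zero, Nielsen.F_mul_G, fun _ => Nielsen.F_mul_C_ne_zero⟩,
    Nielsen.not_isRightMcCoy, fun h => Nielsen.not_isRightMcCoy h.2⟩
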